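/- Let $k$ be an algebraically closed field of characteristic $p>0$ and let $d\ge 1$. Let $\mathcal H_d$ be the Hirzebruch surface of index $d$, that is, the $\mathbb P^1$-bundle over $\mathbb P^1$ associated to $\mathcal O_{\mathbb P^1}\oplus\mathcal O_{\mathbb P^1}(d)$, presented as the union of the four affine planes with coordinate rings $k[x,y]$, $k[x^dy,1/x]$, $k[1/x,1/(x^dy)]$ and $k[1/y,x]$, glued inside the common function field $k(\mathcal H_d)=k(x,y)$. For a nonzero rational vector field $\delta\in\mathrm{Der}_k\,k(\mathcal H_d)$, write $\delta=\alpha\,(f\,\partial/\partial s+g\,\partial/\partial t)$ on each of these planes, where $s,t$ are its coordinates, $f,g$ are regular functions on it without common factors, and $\alpha\in k(\mathcal H_d)^\times$. Let $\mathrm{div}(\delta)$ be the divisor obtained by glueing the divisors $\mathrm{div}(\alpha)$, and let $\mathcal O_{\mathcal H_d}(\mathrm{div}(\delta))$ be the associated invertible sheaf (whose sections on each plane are the quotients $h/\alpha$ with $h$ regular there); when $\delta$ is $p$-closed, it is the invertible $1$-foliation corresponding to $\delta$. Two rational vector fields $\delta,\delta'$ are called equivalent, $\delta\sim\delta'$,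 if $\delta=\beta\delta'$ for some nonzero $\beta\in k(\mathcal H_d)$. Suppose that $\mathcal O_{\mathcal H_d}(\mathrm{div}(\delta))$ has a nonzero global section. Then there are $a_0,a_1,a_2,b\in k$ and $F\in k[x]$ with $\deg F\le d$ such that $$\delta\sim(a_2x^2+a_1x+a_0)\frac{\partial}{\partial x}+\bigl(F(x)\,y-d\,a_2\,x+b\bigr)\,y\,\frac{\partial}{\partial y}.$$ -/

import Mathlib

noncomputable section

namespace Hirzebruch

/-- The function field `k(x, y)` of the Hirzebruch surface. -/
abbrev RatFun (k : Type*) [Field k] : Type _ := FractionRing (MvPolynomial (Fin 2) k)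

/-- The rational function `x`. -/
def x (k : Type*) [Field k] : RatFun k := algebraMap (MvPolynomial (Fin 2) k) _ (MvPolynomial.X 0)

/-- The rational function `y`. -/
def y (k : Type*) [Field k] : RatFun k := algebraMap (MvPolynomial (Fin 2) k) _ (MvPolynomial.X 1)

/-- The coordinates of the four standard affine planes covering the Hirzebruch surface of index
`d`, as elements of the function field: `(x, y)`, `(z, w) = (x ^ d y, 1 / x)`,
`(s, t) = (1 / x, 1 / (x ^ d y))` and `(u, v) = (1 / y, x)`. -/
def coord (k : Type*) [Field k] (d : ℕ) : Fin 4 → Fin 2 → RatFun k :=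
  ![![x k, y k],
    ![x k ^ d * y k, (x k)⁻¹],
    ![(x k)⁻¹, (x k ^ d * y k)⁻¹],
    ![(y k)⁻¹, x k]]

/-- The affine coordinate ring of the `i`-th standard affine open `U i`. The Hirzebruch surface
of index `d` is the integral separated surface with function field `k(x, y)` obtained by glueing
the four planes `U i = Spec (chart k d i)` inside this common function field. -/
def chart (k : Type*) [Field k] (d : ℕ) (i : Fin 4) : Subalgebra k (RatFun k) :=
  Algebra.adjoin k (Set.range (coord k d i))

/-- The coordinate ring of the affine open `U i ∩ U j`: it is generated by the coordinate rings
of `U i` and `U j`, since the surface is separated. -/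
def overlap (k : Type*) [Field k] (d : ℕ) (i j : Fin 4) : Subalgebra k (RatFun k) :=
  chart k d i ⊔ chart k d j

/-- A (Cartier) divisor on the Hirzebruch surface, given by a nonzero rational function on each
`U i` (its local equation there), such that on `U i ∩ U j` the local equations differ by
a unit. Every divisor is of this form, since every divisor on an affine plane is principal. -/
structure Divisor (k : Type*) [Field k] (d : ℕ) where
  /-- The local equation on `U i`. -/
  eqn : Fin 4 → RatFun k
  eqn_ne_zero : ∀ i, eqn i ≠ 0
  /-- With `i` and `j` exchanged, this also gives that the inverse is regular. -/
  eqn_div_mem : ∀ i j, eqn i / eqn j ∈ overlap k d i j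

/-- The sections over `U i` of the invertible sheaf `O(D)`, as a subsheaf of the constant sheaf
of rational functions: the quotients `h / α` with `h` regular on `U i`, where `α` is the local
equation of `D` on `U i`. -/
def Divisor.sectionsOn {k : Type*} [Field k] {d : ℕ} (D : Divisor k d) (i : Fin 4) :
    Submodule k (RatFun k) where
  carrier := {φ | ∃ h ∈ chart k d i, φ = h / D.eqn i}
  zero_mem' := ⟨0, zero_mem _, by simp⟩
  add_mem' := by
    rintro _ _ ⟨a, ha, rfl⟩ ⟨b, hb, rfl⟩
    exact ⟨a + b, add_mem ha hb, by rw [add_div]⟩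
  smul_mem' := by
    rintro c _ ⟨a, ha, rfl⟩
    exact ⟨c • a, Subalgebra.smul_mem _ ha c, by rw [smul_div_assoc]⟩

/-- The space `H⁰(O(D))` of global sections of `O(D)`. -/
def Divisor.globalSections {k : Type*} [Field k] {d : ℕ} (D : Divisor k d) :
    Submodule k (RatFun k) :=
  ⨅ i, D.sectionsOn i

/-- A rational vector field: a `k`-derivation of the function field. -/
abbrev VectorField (k : Type*) [Field k] : Type _ := Derivation k (RatFun k) (RatFun k)

/-- Two rational vector fields are equivalent if they differ by a nonzero rational function. -/
def Equivalent {k : Type*} [Field k] (δ δ' : VectorField k) : Prop :=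
  ∃ α : RatFun k, α ≠ 0 ∧ δ = α • δ'

/-- `α` is a local equation of `div δ` on `U i`: in the coordinates `s, t` of `U i` one has
`δ = α (f ∂/∂s + g ∂/∂t)` with `f`, `g` regular on `U i` without common factors. (The coefficients
of a derivation `δ` in `∂/∂s` and `∂/∂t` are `δ s` and `δ t`.) -/
def IsLocalEquation {k : Type*} [Field k] (d : ℕ) (δ : VectorField k) (i : Fin 4)
    (α : RatFun k) : Prop :=
  α ≠ 0 ∧ ∃ f g : chart k d i, IsRelPrime f g ∧
    δ (coord k d i 0) = α * f ∧ δ (coord k d i 1) = α * g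

/-- `D` is the divisor associated to `δ`. -/
def IsDivisorOf {k : Type*} [Field k] {d : ℕ} (δ : VectorField k) (D : Divisor k d) : Prop :=
  ∀ i, IsLocalEquation d δ i (D.eqn i)

section WellDefined

variable {k : Type*} [Field k]

theorem x_ne_zero : x k ≠ 0 := by
  simp [x]

theorem y_ne_zero : y k ≠ 0 := by
  simp [y]

theorem coord_ne_zero (d : ℕ) (i : Fin 4) (j : Fin 2) : coord k d i j ≠ 0 := by
  have hx := x_ne_zero (k := k)
  have hy := y_ne_zero (k := k)
  fin_cases i <;> fin_cases j <;> simp [coord, hx, hy]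

theorem coord_mem (d : ℕ) (i : Fin 4) (j : Fin 2) : coord k d i j ∈ chart k d i :=
  Algebra.subset_adjoin ⟨j, rfl⟩

theorem adjoin_x_y : IntermediateField.adjoin k {x k, y k} = ⊤ := by
  rw [eq_top_iff]
  intro a _
  obtain ⟨p, q, -, rfl⟩ := IsFractionRing.div_surjective (A := MvPolynomial (Fin 2) k) a
  have key : ∀ p : MvPolynomial (Fin 2) k, algebraMap _ (RatFun k) p ∈
      IntermediateField.adjoin k {x k, y k} := by
    intro p
    induction p using MvPolynomial.induction_on with
    | C c =>
      have : algebraMap (MvPolynomial (Fin 2) k) (RatFun k) (MvPolynomial.C c)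
          = algebraMap k (RatFun k) c := by
        rw [IsScalarTower.algebraMap_apply k (MvPolynomial (Fin 2) k) (RatFun k)]
        rfl
      rw [this]
      exact IntermediateField.algebraMap_mem _ c
    | add p q hp hq => rw [map_add]; exact add_mem hp hq
    | mul_X p i hp =>
      rw [map_mul]
      refine mul_mem hp (IntermediateField.subset_adjoin _ _ ?_)
      fin_cases i
      · exact Or.inl rfl
      · exact Or.inr rfl
  exact div_mem (key p) (key q)

theorem adjoin_coord (d : ℕ) (i : Fin 4) :
    IntermediateField.adjoin k (Set.range (coord k d i)) = ⊤ := by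
  rw [eq_top_iff, ← adjoin_x_y, IntermediateField.adjoin_le_iff]
  set L := IntermediateField.adjoin k (Set.range (coord k d i)) with hL
  have h0 : coord k d i 0 ∈ L := IntermediateField.subset_adjoin _ _ ⟨0, rfl⟩
  have h1 : coord k d i 1 ∈ L := IntermediateField.subset_adjoin _ _ ⟨1, rfl⟩
  have hx0 := x_ne_zero (k := k)
  have hy0 := y_ne_zero (k := k)
  clear_value L
  have : x k ∈ L ∧ y k ∈ L := by
    fin_cases i <;> simp only [coord, Fin.zero_eta, Fin.mk_one, Fin.reduceFinMk,
      Matrix.cons_val, Matrix.cons_val_zero, Matrix.cons_val_one] at h0 h1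
    · exact ⟨h0, h1⟩
    · have hx : x k ∈ L := by simpa using inv_mem h1
      refine ⟨hx, ?_⟩
      have := div_mem h0 (pow_mem hx d)
      rwa [mul_div_cancel_left₀ _ (pow_ne_zero _ hx0)] at this
    · have hx : x k ∈ L := by simpa using inv_mem h0
      refine ⟨hx, ?_⟩
      have := div_mem (inv_mem h1) (pow_mem hx d)
      rwa [inv_inv, mul_div_cancel_left₀ _ (pow_ne_zero _ hx0)] at this
    · exact ⟨h1, by simpa using inv_mem h0⟩
  rintro a (rfl | rfl)
  exacts [this.1, this.2]

theorem exists_div (d : ℕ) (i : Fin 4) (a : RatFun k) :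
    ∃ r ∈ chart k d i, ∃ s ∈ chart k d i, s ≠ 0 ∧ a = r / s := by
  have ha : a ∈ IntermediateField.adjoin k (Set.range (coord k d i)) := by
    rw [adjoin_coord]; trivial
  obtain ⟨r, hr, s, hs, h⟩ := IntermediateField.mem_adjoin_iff_div.1 ha
  by_cases h0 : s = 0
  · exact ⟨0, zero_mem _, 1, one_mem _, one_ne_zero, by simp [h, h0]⟩
  · exact ⟨r, hr, s, hs, h0, h⟩

instance isFractionRing_chart (d : ℕ) (i : Fin 4) : IsFractionRing (chart k d i) (RatFun k) := by
  refine IsFractionRing.of_field _ _ fun a => ?_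
  obtain ⟨r, hr, s, hs, h0, h⟩ := exists_div d i a
  exact ⟨⟨r, hr⟩, ⟨s, hs⟩, h⟩

theorem trdeg_ratFun : Algebra.trdeg k (RatFun k) = 2 := by
  have h : IsTranscendenceBasis k (fun i : Fin 2 => algebraMap (MvPolynomial (Fin 2) k) (RatFun k)
      (MvPolynomial.X i)) := by
    have hb := IsTranscendenceBasis.mvPolynomial (Fin 2) k
    have : Algebra.IsAlgebraic (MvPolynomial (Fin 2) k) (RatFun k) :=
      IsLocalization.isAlgebraic _ (nonZeroDivisors (MvPolynomial (Fin 2) k))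
    exact hb.algebraMap_comp (A := RatFun k)
  have := h.lift_cardinalMk_eq_trdeg
  simpa using this.symm

theorem algebraicIndependent_coord (d : ℕ) (i : Fin 4) :
    AlgebraicIndependent k (coord k d i) := by
  have : Algebra.IsAlgebraic (Algebra.adjoin k (Set.range (coord k d i))) (RatFun k) :=
    haveI : IsFractionRing (Algebra.adjoin k (Set.range (coord k d i))) (RatFun k) :=
      isFractionRing_chart d i
    IsLocalization.isAlgebraic _
      (nonZeroDivisors (Algebra.adjoin k (Set.range (coord k d i))))
  exact (Algebra.IsAlgebraic.isTranscendenceBasis_of_lift_le_trdeg_of_finite k (coord k d i)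
    (by rw [trdeg_ratFun]; simp)).1

instance ufd_chart (d : ℕ) (i : Fin 4) : UniqueFactorizationMonoid (chart k d i) :=
  ((algebraicIndependent_coord (k := k) d i).aevalEquiv.toMulEquiv).uniqueFactorizationMonoid
    inferInstance

/-- A derivation that vanishes on the coordinates of a chart is zero. -/
theorem eq_zero_of_coord (d : ℕ) (i : Fin 4) (δ : VectorField k)
    (h0 : δ (coord k d i 0) = 0) (h1 : δ (coord k d i 1) = 0) : δ = 0 := by
  have key : ∀ r ∈ chart k d i, δ r = 0 := by
    intro r hr
    induction hr using Algebra.adjoin_induction with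
    | mem a ha =>
      obtain ⟨j, rfl⟩ := ha
      fin_cases j
      exacts [h0, h1]
    | algebraMap c => simp
    | add a b _ _ ha hb => simp [ha, hb]
    | mul a b _ _ ha hb => simp [ha, hb]
  ext a
  obtain ⟨r, hr, s, hs, hs0, rfl⟩ := exists_div d i a
  simp [Derivation.leibniz_div, key r hr, key s hs]

theorem exists_isLocalEquation (d : ℕ) (i : Fin 4) {δ : VectorField k} (hδ : δ ≠ 0) :
    ∃ α, IsLocalEquation d δ i α := by
  obtain ⟨r, hr, s, hs, hs0, h0⟩ := exists_div d i (δ (coord k d i 0))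
  obtain ⟨r', hr', s', hs', hs0', h1⟩ := exists_div d i (δ (coord k d i 1))
  let _ : GCDMonoid (chart k d i) := UniqueFactorizationMonoid.toGCDMonoid _
  let A : chart k d i := ⟨r * s', mul_mem hr hs'⟩
  let B : chart k d i := ⟨r' * s, mul_mem hr' hs⟩
  obtain ⟨f, g, hA, hB, hu⟩ := extract_gcd A B
  have hA' : r * s' = (gcd A B : chart k d i) * (f : RatFun k) := congrArg Subtype.val hA
  have hB' : r' * s = (gcd A B : chart k d i) * (g : RatFun k) := congrArg Subtype.val hB
  have e0 : δ (coord k d i 0) = (gcd A B : chart k d i) / (s * s') * (f : RatFun k) := by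
    rw [h0]; field_simp; linear_combination hA'
  have e1 : δ (coord k d i 1) = (gcd A B : chart k d i) / (s * s') * (g : RatFun k) := by
    rw [h1]; field_simp; linear_combination hB'
  refine ⟨(gcd A B : chart k d i) / (s * s'), ?_, f, g, ?_, e0, e1⟩
  · intro hz
    exact hδ (eq_zero_of_coord d i δ (by rw [e0, hz, zero_mul]) (by rw [e1, hz, zero_mul]))
  · intro c hf hg
    exact isUnit_of_dvd_unit (dvd_gcd hf hg) hu

theorem monomial_mem {d : ℕ} {i : Fin 4} {R : Subalgebra k (RatFun k)} (h : chart k d i ≤ R)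
    (a b : ℕ) : coord k d i 0 ^ a * coord k d i 1 ^ b ∈ R :=
  mul_mem (pow_mem (h (coord_mem d i 0)) a) (pow_mem (h (coord_mem d i 1)) b)

theorem basic_open_aux (d : ℕ) (i j : Fin 4) (e e' a b a' b' n p q n' p' q' : ℕ)
    (hm : (coord k d j 0 ^ e * coord k d j 1 ^ e')⁻¹ =
      coord k d i 0 ^ a * coord k d i 1 ^ b * (coord k d j 0 ^ a' * coord k d j 1 ^ b'))
    (h0 : (coord k d j 0 ^ e * coord k d j 1 ^ e') ^ n * coord k d i 0 =
      coord k d j 0 ^ p * coord k d j 1 ^ q)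
    (h1 : (coord k d j 0 ^ e * coord k d j 1 ^ e') ^ n' * coord k d i 1 =
      coord k d j 0 ^ p' * coord k d j 1 ^ q') :
    ∃ m ∈ chart k d j, m ≠ 0 ∧
      m⁻¹ ∈ overlap k d i j ∧ ∀ r ∈ overlap k d i j, ∃ n : ℕ, m ^ n * r ∈ chart k d j := by
  have hmem : coord k d j 0 ^ e * coord k d j 1 ^ e' ∈ chart k d j := monomial_mem le_rfl e e'
  refine ⟨coord k d j 0 ^ e * coord k d j 1 ^ e', hmem,
    mul_ne_zero (pow_ne_zero _ (coord_ne_zero d j 0)) (pow_ne_zero _ (coord_ne_zero d j 1)),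
    ?_, ?_⟩
  · rw [hm]
    exact mul_mem (monomial_mem le_sup_left a b) (monomial_mem le_sup_right a' b')
  · generalize coord k d j 0 ^ e * coord k d j 1 ^ e' = m at *
    intro r hr
    rw [overlap, chart, chart, ← Algebra.adjoin_union] at hr
    induction hr using Algebra.adjoin_induction with
    | mem r hr =>
      rcases hr with ⟨c, rfl⟩ | ⟨c, rfl⟩
      · fin_cases c
        · exact ⟨n, h0 ▸ monomial_mem le_rfl p q⟩
        · exact ⟨n', h1 ▸ monomial_mem le_rfl p' q'⟩
      · exact ⟨0, by simpa using coord_mem d j c⟩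
    | algebraMap c => exact ⟨0, by simp⟩
    | add r s _ _ hr hs =>
      obtain ⟨n, hn⟩ := hr
      obtain ⟨l, hl⟩ := hs
      refine ⟨n + l, ?_⟩
      have : m ^ (n + l) * (r + s) = m ^ l * (m ^ n * r) + m ^ n * (m ^ l * s) := by ring
      rw [this]
      exact add_mem (mul_mem (pow_mem hmem l) hn) (mul_mem (pow_mem hmem n) hl)
    | mul r s _ _ hr hs =>
      obtain ⟨n, hn⟩ := hr
      obtain ⟨l, hl⟩ := hs
      refine ⟨n + l, ?_⟩
      have : m ^ (n + l) * (r * s) = (m ^ n * r) * (m ^ l * s) := by ring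
      rw [this]
      exact mul_mem hn hl

/-- `U i ∩ U j` is the basic open subset of `U j` where some `m` does not vanish. -/
theorem exists_basic_open (d : ℕ) (i j : Fin 4) : ∃ m ∈ chart k d j, m ≠ 0 ∧
    m⁻¹ ∈ overlap k d i j ∧ ∀ r ∈ overlap k d i j, ∃ n : ℕ, m ^ n * r ∈ chart k d j := by
  have hx := x_ne_zero (k := k)
  have hy := y_ne_zero (k := k)
  by_cases hij : i = j
  · subst hij
    exact ⟨1, one_mem _, one_ne_zero, by simp, fun r hr => ⟨0, by simpa [overlap] using hr⟩⟩
  fin_cases i <;> fin_cases j <;> first | exact absurd rfl hij | skip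
  · refine basic_open_aux d 0 1  0 1  1 0 0 0  1 0 0  0 1 d ?_ ?_ ?_
    all_goals simp [coord]
    all_goals try field_simp
  · refine basic_open_aux d 0 2  1 1  (d + 1) 1 0 0  1 0 1  1 (d + 1) 0 ?_ ?_ ?_
    all_goals simp [coord]
    all_goals try field_simp
    all_goals try ring
  · refine basic_open_aux d 0 3  1 0  0 1 0 0  0 0 1  1 0 0 ?_ ?_ ?_
    all_goals simp [coord]
    all_goals try field_simp
  · refine basic_open_aux d 1 0  1 0  0 1 0 0  0 d 1  1 0 0 ?_ ?_ ?_
    all_goals simp [coord]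
    all_goals try field_simp
  · refine basic_open_aux d 1 2  0 1  1 0 0 0  1 0 0  0 1 0 ?_ ?_ ?_
    all_goals simp [coord]
    all_goals try field_simp
  · refine basic_open_aux d 1 3  1 1  1 (d + 1) 0 0  1 0 (d + 1)  1 1 0 ?_ ?_ ?_
    all_goals simp [coord]
    all_goals try field_simp
    all_goals try ring
  · refine basic_open_aux d 2 0  1 1  1 1 d 0  1 0 1  (d + 1) 1 d ?_ ?_ ?_
    all_goals simp [coord]
    all_goals try field_simp
    all_goals try ring
  · refine basic_open_aux d 2 1  1 0  0 1 0 0  0 0 1  1 0 0 ?_ ?_ ?_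
    all_goals simp [coord]
    all_goals try field_simp
  · refine basic_open_aux d 2 3  0 1  1 0 0 0  1 0 0  d 1 0 ?_ ?_ ?_
    all_goals simp [coord]
    all_goals try field_simp
  · refine basic_open_aux d 3 0  0 1  1 0 0 0  1 0 0  0 1 0 ?_ ?_ ?_
    all_goals simp [coord]
    all_goals try field_simp
  · refine basic_open_aux d 3 1  1 1  1 1 0 d  (d + 1) d 1  1 1 0 ?_ ?_ ?_
    all_goals simp [coord]
    rotate_left
    · rw [mul_pow, inv_pow]
      field_simp
      ring
    all_goals try field_simp
  · refine basic_open_aux d 3 2  1 0  0 1 0 0  d 0 1  1 0 0 ?_ ?_ ?_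
    all_goals simp [coord]
    all_goals try field_simp

/-- Local equations of `div δ` on `U i` and `U j` differ by a unit on `U i ∩ U j`. -/
theorem localEquation_div_mem {d : ℕ} {δ : VectorField k} {i j : Fin 4} {α β : RatFun k}
    (hα : IsLocalEquation d δ i α) (hβ : IsLocalEquation d δ j β) :
    α / β ∈ overlap k d i j := by
  obtain ⟨hα0, f, g, hfg, hf, hg⟩ := hα
  obtain ⟨hβ0, f', g', -, hf', hg'⟩ := hβ
  have hle : chart k d i ≤ overlap k d i j := le_sup_left
  have hle' : chart k d j ≤ overlap k d i j := le_sup_right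
  have hj : ∀ r ∈ chart k d j, δ r / β ∈ overlap k d i j := by
    intro r hr
    have hr' := hr
    rw [chart] at hr'
    induction hr' using Algebra.adjoin_induction with
    | mem a ha =>
      obtain ⟨c, rfl⟩ := ha
      fin_cases c
      · refine hle' ?_
        have : δ (coord k d j 0) / β = f' := by rw [hf']; field_simp
        exact this ▸ f'.2
      · refine hle' ?_
        have : δ (coord k d j 1) / β = g' := by rw [hg']; field_simp
        exact this ▸ g'.2
    | algebraMap c => simp
    | add a b ha hb iha ihb =>
      rw [map_add, add_div]; exact add_mem (iha ha) (ihb hb)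
    | mul a b ha hb iha ihb =>
      rw [Derivation.leibniz, smul_eq_mul, smul_eq_mul, add_div, mul_div_assoc, mul_div_assoc]
      exact add_mem (mul_mem (hle' ha) (ihb hb)) (mul_mem (hle' hb) (iha ha))
  have hi : ∀ r ∈ overlap k d i j, δ r / β ∈ overlap k d i j := by
    intro r hr
    obtain ⟨m, hm, hm0, hinv, hex⟩ := exists_basic_open (k := k) d i j
    obtain ⟨n, hn⟩ := hex r hr
    have h1 := hj _ hn
    have h2 := hj _ (pow_mem hm n)
    have : δ r / β = (m⁻¹) ^ n * (δ (m ^ n * r) / β - r * (δ (m ^ n) / β)) := by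
      rw [Derivation.leibniz, smul_eq_mul, smul_eq_mul]
      rw [inv_pow]
      field_simp
      ring
    rw [this]
    exact mul_mem (pow_mem hinv n) (sub_mem h1 (mul_mem hr h2))
  obtain ⟨m, hm, hm0, hinv, hex⟩ := exists_basic_open (k := k) d j i
  have hcomm : overlap k d j i = overlap k d i j := sup_comm _ _
  rw [hcomm] at hinv hex
  have hA := hi _ (hle (coord_mem d i 0))
  have hB := hi _ (hle (coord_mem d i 1))
  obtain ⟨n, hn⟩ := hex _ hA
  obtain ⟨l, hl⟩ := hex _ hB
  suffices h : m ^ (n + l) * (α / β) ∈ chart k d i by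
    have e : α / β = (m⁻¹) ^ (n + l) * (m ^ (n + l) * (α / β)) := by
      rw [inv_pow, inv_mul_cancel_left₀ (pow_ne_zero _ hm0)]
    rw [e]
    exact mul_mem (pow_mem hinv _) (hle h)
  let A : chart k d i := ⟨m ^ l * (m ^ n * (δ (coord k d i 0) / β)), mul_mem (pow_mem hm l) hn⟩
  let B : chart k d i := ⟨m ^ n * (m ^ l * (δ (coord k d i 1) / β)), mul_mem (pow_mem hm n) hl⟩
  have eA : (A : RatFun k) = m ^ (n + l) * (α / β) * f := by
    simp only [A, hf]; ring
  have eB : (B : RatFun k) = m ^ (n + l) * (α / β) * g := by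
    simp only [B, hg]; ring
  have hAB : A * g = B * f := by
    apply Subtype.ext
    simp only [MulMemClass.coe_mul, eA, eB]
    ring
  by_cases hf0 : f = 0
  · subst hf0
    obtain ⟨v, hv⟩ := (isRelPrime_zero_left.1 hfg).exists_right_inv
    have hv' : (g : RatFun k) * v = 1 := congrArg Subtype.val hv
    have : m ^ (n + l) * (α / β) = ((B * v : chart k d i) : RatFun k) := by
      simp only [MulMemClass.coe_mul, eB]
      linear_combination -(m ^ (n + l) * (α / β)) * hv'
    rw [this]
    exact (B * v).2
  · obtain ⟨c, hc⟩ : f ∣ A := by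
      apply hfg.dvd_of_dvd_mul_right
      exact ⟨B, by rw [hAB, mul_comm]⟩
    have hf0' : (f : RatFun k) ≠ 0 := fun h => hf0 (Subtype.ext h)
    have : m ^ (n + l) * (α / β) = (c : RatFun k) := by
      apply mul_right_cancel₀ hf0'
      rw [← eA, hc, MulMemClass.coe_mul, mul_comm]
    rw [this]
    exact c.2

theorem exists_isDivisorOf (d : ℕ) {δ : VectorField k} (hδ : δ ≠ 0) :
    ∃ D : Divisor k d, IsDivisorOf δ D := by
  choose α hα using fun i => exists_isLocalEquation d i hδ
  exact ⟨⟨α, fun i => (hα i).1, fun i j => localEquation_div_mem (hα i) (hα j)⟩, hα⟩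

end WellDefined

/-- The divisor `div δ` of a nonzero rational vector field `δ`. Its local equation on `U i` is
determined up to units of the coordinate ring of `U i`, so that `O(div δ)` does not depend on
the choice. -/
def divisor {k : Type*} [Field k] (d : ℕ) (δ : VectorField k) (hδ : δ ≠ 0) : Divisor k d :=
  (exists_isDivisorOf d hδ).choose

theorem isDivisorOf_divisor {k : Type*} [Field k] (d : ℕ) (δ : VectorField k) (hδ : δ ≠ 0) :
    IsDivisorOf δ (divisor d δ hδ) :=
  (exists_isDivisorOf d hδ).choose_spec

/-- Each partial derivative of `k[x, y]` extends to the function field. -/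
theorem exists_partial (k : Type*) [Field k] (i : Fin 2) : ∃ D : VectorField k,
    ∀ p : MvPolynomial (Fin 2) k, D (algebraMap _ _ p) =
      algebraMap _ _ (MvPolynomial.pderiv i p) := by
  have := Algebra.FormallyEtale.of_isLocalization (Rₘ := RatFun k)
    (nonZeroDivisors (MvPolynomial (Fin 2) k))
  let e := KaehlerDifferential.tensorKaehlerEquivOfFormallyEtale k (MvPolynomial (Fin 2) k)
    (RatFun k)
  let D₀ : Derivation k (MvPolynomial (Fin 2) k) (RatFun k) :=
    (Algebra.linearMap (MvPolynomial (Fin 2) k) (RatFun k)).compDer (MvPolynomial.pderiv i)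
  let L : Ω[RatFun k⁄k] →ₗ[RatFun k] RatFun k :=
    (LinearMap.liftBaseChange (RatFun k) D₀.liftKaehlerDifferential) ∘ₗ e.symm.toLinearMap
  refine ⟨L.compDer (KaehlerDifferential.D k (RatFun k)), fun p => ?_⟩
  have h : e.symm (KaehlerDifferential.D k (RatFun k) (algebraMap _ _ p)) = _ :=
    KaehlerDifferential.tensorKaehlerEquivOfFormallyEtale_symm_D_algebraMap k
      (MvPolynomial (Fin 2) k) (RatFun k) p
  change L (KaehlerDifferential.D k (RatFun k) (algebraMap _ _ p)) = _
  simp only [L, LinearMap.comp_apply, LinearEquiv.coe_coe, h, LinearMap.liftBaseChange_tmul,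
    one_smul, Derivation.liftKaehlerDifferential_comp_D]
  rfl

/-- `∂/∂x` (for `i = 0`) and `∂/∂y` (for `i = 1`). -/
def partialDeriv (k : Type*) [Field k] (i : Fin 2) : VectorField k :=
  (exists_partial k i).choose

theorem partialDeriv_algebraMap {k : Type*} [Field k] (i : Fin 2) (p : MvPolynomial (Fin 2) k) :
    partialDeriv k i (algebraMap _ _ p) = algebraMap _ _ (MvPolynomial.pderiv i p) :=
  (exists_partial k i).choose_spec p

end Hirzebruch

end

/-! On each plane a global section of `O(div δ)` is `φ = h / α` with `h` regular, so `φ • δ = h (f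
∂/∂s + g ∂/∂t)` has no poles there. A nonzero section thus replaces `δ` by an equivalent vector
field `D` regular on the whole surface, and it remains to classify such `D` (`IsRegular.exists_eq`).

The surface is toric: Laurent monomials in `x, y` are linearly independent, each chart lies in the
span of the monomials with exponents in a cone, and such spans intersect as their exponent sets do
(`laurentSpan_inf`). Regularity of `D` therefore becomes a set of inequalities on the exponents `(a,
b)` in `D x` and `D y`. For `D x` they leave `b = 0` and `0 ≤ a ≤ 2`, a quadratic in `x`. For `D y`,
the chart with coordinate `x ^ d * y` couples it to `D x` and forces the term `-d a₂ x y`; what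
remains lies in `k y + ⟨1, x, …, x ^ d⟩ y ^ 2`. The charts 0, 1 and 3 suffice: they omit a single
point. -/

namespace Hirzebruch

/-! ### Laurent monomials and the exponent cones of the charts -/

section LaurentMonomials

variable {k : Type*} [Field k]

/-- The Laurent monomial `x ^ a * y ^ b`. -/
noncomputable def laurentMonomial (k : Type*) [Field k] (n : ℤ × ℤ) : RatFun k :=
  x k ^ n.1 * y k ^ n.2

theorem laurentMonomial_add (m n : ℤ × ℤ) :
    laurentMonomial k (m + n) = laurentMonomial k m * laurentMonomial k n := by
  simp only [laurentMonomial, Prod.fst_add, Prod.snd_add, zpow_add₀ (x_ne_zero (k := k)),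
    zpow_add₀ (y_ne_zero (k := k))]
  ring

theorem laurentMonomial_natCast (s : Fin 2 →₀ ℕ) :
    laurentMonomial k (s 0, s 1) = algebraMap _ _ (MvPolynomial.monomial s (1 : k)) := by
  rw [MvPolynomial.monomial_eq, MvPolynomial.C_1, one_mul,
    Finsupp.prod_fintype _ _ (fun _ => pow_zero _), Fin.prod_univ_two]
  simp [laurentMonomial, x, y]

/-- Multiplying a finite relation by a high power of `x * y` makes all exponents nonnegative, and
monomials of `k[x, y]` are independent. -/
theorem linearIndependent_laurentMonomial : LinearIndependent k (laurentMonomial k) := by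
  have hmon : LinearIndependent k (fun s : Fin 2 →₀ ℕ => laurentMonomial k (s 0, s 1)) := by
    have h := (MvPolynomial.basisMonomials (Fin 2) k).linearIndependent.map'
      (IsScalarTower.toAlgHom k (MvPolynomial (Fin 2) k) (RatFun k)).toLinearMap
      (LinearMap.ker_eq_bot.2 (IsFractionRing.injective _ _))
    have e : (fun s : Fin 2 →₀ ℕ => laurentMonomial k (s 0, s 1)) =
        (IsScalarTower.toAlgHom k (MvPolynomial (Fin 2) k) (RatFun k)).toLinearMap ∘
          MvPolynomial.basisMonomials (Fin 2) k := by
      funext s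
      simp [laurentMonomial_natCast]
    rw [e]
    exact h
  rw [linearIndependent_iff'] at hmon ⊢
  intro s g hg i hi
  -- A crude bound on all exponents of the relation: shifting by `(N, N)` makes them natural
  -- numbers, so `toNat` below loses nothing.
  let N : ℤ := ∑ j ∈ s, (|j.1| + |j.2|)
  have hN : ∀ j ∈ s, 0 ≤ j.1 + N ∧ 0 ≤ j.2 + N := by
    intro j hj
    have h : |j.1| + |j.2| ≤ N :=
      Finset.single_le_sum (f := fun j : ℤ × ℤ => |j.1| + |j.2|) (fun _ _ => by positivity) hj
    have h1 := neg_abs_le j.1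
    have h2 := neg_abs_le j.2
    have h3 := abs_nonneg j.1
    have h4 := abs_nonneg j.2
    constructor <;> linarith
  let e : ℤ × ℤ → (Fin 2 →₀ ℕ) := fun j =>
    Finsupp.equivFunOnFinite.symm ![(j.1 + N).toNat, (j.2 + N).toNat]
  have e0 : ∀ j ∈ s, ((e j 0 : ℕ) : ℤ) = j.1 + N := fun j hj => by
    simp [e, (hN j hj).1]
  have e1 : ∀ j ∈ s, ((e j 1 : ℕ) : ℤ) = j.2 + N := fun j hj => by
    simp [e, (hN j hj).2]
  have hinj : Set.InjOn e s := by
    intro a ha b hb hab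
    have h0 := e0 a ha
    have h1 := e1 a ha
    rw [hab] at h0 h1
    have h0' := e0 b hb
    have h1' := e1 b hb
    ext <;> linarith
  have key := hmon (s.image e) (fun t => g (((t 0 : ℕ) : ℤ) - N, ((t 1 : ℕ) : ℤ) - N)) (by
    rw [Finset.sum_image hinj]
    calc _ = ∑ j ∈ s, (g j • laurentMonomial k j) * laurentMonomial k (N, N) := by
          refine Finset.sum_congr rfl fun j hj => ?_
          rw [e0 j hj, e1 j hj, smul_mul_assoc, ← laurentMonomial_add]
          simp only [add_sub_cancel_right]
          rfl
      _ = 0 := by rw [← Finset.sum_mul, hg, zero_mul]) (e i) (Finset.mem_image_of_mem e hi)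
  simpa [e0 i hi, e1 i hi] using key

/-- The Laurent polynomials with exponents in a given set. -/
noncomputable def laurentSpan (k : Type*) [Field k] (S : Set (ℤ × ℤ)) : Submodule k (RatFun k) :=
  Submodule.span k (laurentMonomial k '' S)

theorem laurentMonomial_mem {S : Set (ℤ × ℤ)} {n : ℤ × ℤ} (hn : n ∈ S) :
    laurentMonomial k n ∈ laurentSpan k S :=
  Submodule.subset_span ⟨n, hn, rfl⟩

theorem laurentSpan_mono {S T : Set (ℤ × ℤ)} (h : S ⊆ T) : laurentSpan k S ≤ laurentSpan k T :=
  Submodule.span_mono (Set.image_mono h)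

/-- Independence makes the linear combination map injective, and images under an injective map
commute with intersections. -/
theorem laurentSpan_inf (S T : Set (ℤ × ℤ)) :
    laurentSpan k S ⊓ laurentSpan k T = laurentSpan k (S ∩ T) := by
  simp only [laurentSpan, Finsupp.span_image_eq_map_linearCombination]
  rw [Finsupp.supported_inter, Submodule.map_inf _ linearIndependent_laurentMonomial]

theorem mul_mem_laurentSpan {S T U : Set (ℤ × ℤ)} (h : ∀ m ∈ S, ∀ n ∈ T, m + n ∈ U)
    {f g : RatFun k} (hf : f ∈ laurentSpan k S) (hg : g ∈ laurentSpan k T) :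
    f * g ∈ laurentSpan k U := by
  have hle : laurentSpan k S * laurentSpan k T ≤ laurentSpan k U := by
    rw [laurentSpan, laurentSpan, Submodule.span_mul_span]
    refine Submodule.span_le.2 ?_
    rintro _ ⟨_, ⟨m, hm, rfl⟩, _, ⟨n, hn, rfl⟩, rfl⟩
    simp only [← laurentMonomial_add]
    exact laurentMonomial_mem (h m hm n hn)
  exact hle (Submodule.mul_mem_mul hf hg)

theorem laurentMonomial_mul_mem {S U : Set (ℤ × ℤ)} (m : ℤ × ℤ) (h : ∀ n ∈ S, m + n ∈ U)
    {f : RatFun k} (hf : f ∈ laurentSpan k S) : laurentMonomial k m * f ∈ laurentSpan k U :=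
  mul_mem_laurentSpan (S := {m}) (by simpa using h) (laurentMonomial_mem rfl) hf

/-- The span of the monomials with exponents in a monoid is closed under products, so only the
generators of the chart need checking. -/
theorem chart_le_laurentSpan {d : ℕ} {i : Fin 4} (S : AddSubmonoid (ℤ × ℤ))
    (h : ∀ j, ∃ n ∈ S, coord k d i j = laurentMonomial k n) {f : RatFun k}
    (hf : f ∈ chart k d i) : f ∈ laurentSpan k S := by
  have h1 : (1 : RatFun k) ∈ laurentSpan k S := by
    simpa [laurentMonomial] using laurentMonomial_mem (k := k) S.zero_mem
  rw [chart] at hf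
  induction hf using Algebra.adjoin_induction with
  | mem a ha =>
    obtain ⟨j, rfl⟩ := ha
    obtain ⟨n, hn, e⟩ := h j
    exact e ▸ laurentMonomial_mem hn
  | algebraMap c => rw [Algebra.algebraMap_eq_smul_one]; exact Submodule.smul_mem _ _ h1
  | add a b _ _ ha hb => exact add_mem ha hb
  | mul a b _ _ ha hb => exact mul_mem_laurentSpan (fun m hm n hn => S.add_mem hm hn) ha hb

theorem chart_zero_le {d : ℕ} {f : RatFun k} (hf : f ∈ chart k d 0) :
    f ∈ laurentSpan k {n | 0 ≤ n.1 ∧ 0 ≤ n.2} := by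
  refine chart_le_laurentSpan
    { carrier := {n | 0 ≤ n.1 ∧ 0 ≤ n.2}
      zero_mem' := ⟨le_rfl, le_rfl⟩
      add_mem' := fun ha hb => ⟨add_nonneg ha.1 hb.1, add_nonneg ha.2 hb.2⟩ } (fun j => ?_) hf
  fin_cases j
  · exact ⟨(1, 0), by simp [← SetLike.mem_coe], by simp [coord, laurentMonomial]⟩
  · exact ⟨(0, 1), by simp [← SetLike.mem_coe], by simp [coord, laurentMonomial]⟩

theorem chart_one_le {d : ℕ} {f : RatFun k} (hf : f ∈ chart k d 1) :
    f ∈ laurentSpan k {n | 0 ≤ n.2 ∧ n.1 ≤ d * n.2} := by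
  refine chart_le_laurentSpan
    { carrier := {n | 0 ≤ n.2 ∧ n.1 ≤ d * n.2}
      zero_mem' := by simp
      add_mem' := fun ha hb => ⟨add_nonneg ha.1 hb.1, by
        simp only [Set.mem_ofPred_eq, Prod.fst_add, Prod.snd_add, mul_add] at *
        linarith [ha.2, hb.2]⟩ } (fun j => ?_) hf
  fin_cases j
  · exact ⟨(d, 1), by simp [← SetLike.mem_coe], by simp [coord, laurentMonomial]⟩
  · exact ⟨(-1, 0), by simp [← SetLike.mem_coe], by simp [coord, laurentMonomial]⟩

theorem chart_three_le {d : ℕ} {f : RatFun k} (hf : f ∈ chart k d 3) :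
    f ∈ laurentSpan k {n | 0 ≤ n.1 ∧ n.2 ≤ 0} := by
  refine chart_le_laurentSpan
    { carrier := {n | 0 ≤ n.1 ∧ n.2 ≤ 0}
      zero_mem' := ⟨le_rfl, le_rfl⟩
      add_mem' := fun ha hb => ⟨add_nonneg ha.1 hb.1, add_nonpos ha.2 hb.2⟩ } (fun j => ?_) hf
  fin_cases j
  · exact ⟨(0, -1), by simp [← SetLike.mem_coe], by simp [coord, laurentMonomial]⟩
  · exact ⟨(1, 0), by simp [← SetLike.mem_coe], by simp [coord, laurentMonomial]⟩

end LaurentMonomials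

/-! ### Classification of regular vector fields -/

section RegularVectorFields

variable {k : Type*} [Field k]

theorem partialDeriv_x (i : Fin 2) : partialDeriv k i (x k) = if i = 0 then 1 else 0 := by
  rw [x, partialDeriv_algebraMap, MvPolynomial.pderiv_X]
  fin_cases i <;> simp

theorem partialDeriv_y (i : Fin 2) : partialDeriv k i (y k) = if i = 1 then 1 else 0 := by
  rw [y, partialDeriv_algebraMap, MvPolynomial.pderiv_X]
  fin_cases i <;> simp

theorem vectorField_eq (D : VectorField k) :
    D = D (x k) • partialDeriv k 0 + D (y k) • partialDeriv k 1 := by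
  rw [← sub_eq_zero]
  refine eq_zero_of_coord 0 0 _ ?_ ?_ <;>
    simp [coord, partialDeriv_x, partialDeriv_y]

/-- A rational vector field without poles on the Hirzebruch surface. -/
def IsRegular (d : ℕ) (D : VectorField k) : Prop :=
  ∀ i j, D (coord k d i j) ∈ chart k d i

/-- The denominator of the section cancels the local equation of the divisor, leaving `h * f` and `h
* g`. -/
theorem isRegular_smul_of_mem_globalSections {d : ℕ} {δ : VectorField k} {E : Divisor k d}
    (hE : IsDivisorOf δ E) {φ : RatFun k} (hφ : φ ∈ E.globalSections) : IsRegular d (φ • δ) := by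
  intro i j
  obtain ⟨hα, f, g, -, hf, hg⟩ := hE i
  obtain ⟨h, hh, rfl⟩ := (Submodule.mem_iInf _).1 hφ i
  rw [Derivation.smul_apply, smul_eq_mul]
  fin_cases j
  · have : h / E.eqn i * δ (coord k d i 0) = h * f := by rw [hf]; field_simp
    exact this ▸ mul_mem hh f.2
  · have : h / E.eqn i * δ (coord k d i 1) = h * g := by rw [hg]; field_simp
    exact this ▸ mul_mem hh g.2

theorem exists_quadratic {A : RatFun k}
    (h : A ∈ laurentSpan k {n | 0 ≤ n.1 ∧ n.1 ≤ 2 ∧ n.2 = 0}) :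
    ∃ a₀ a₁ a₂ : k, A = a₂ • x k ^ 2 + a₁ • x k + algebraMap k _ a₀ := by
  induction h using Submodule.span_induction with
  | mem f hf =>
    obtain ⟨⟨a, b⟩, ⟨h0, h2, hb⟩, rfl⟩ := hf
    dsimp only at h0 h2 hb
    subst hb
    obtain rfl | rfl | rfl : a = 0 ∨ a = 1 ∨ a = 2 := by omega
    · exact ⟨1, 0, 0, by simp [laurentMonomial]⟩
    · exact ⟨0, 1, 0, by simp [laurentMonomial]⟩
    · exact ⟨0, 0, 1, by simp [laurentMonomial, sq]⟩
  | zero => exact ⟨0, 0, 0, by simp⟩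
  | add f g _ _ hf hg =>
    obtain ⟨a₀, a₁, a₂, rfl⟩ := hf
    obtain ⟨b₀, b₁, b₂, rfl⟩ := hg
    exact ⟨a₀ + b₀, a₁ + b₁, a₂ + b₂, by simp only [add_smul, map_add]; ring⟩
  | smul c f _ hf =>
    obtain ⟨a₀, a₁, a₂, rfl⟩ := hf
    exact ⟨c * a₀, c * a₁, c * a₂, by simp only [Algebra.smul_def, map_mul]; ring⟩

theorem exists_linear_add_quadratic {d : ℕ} {B : RatFun k}
    (h : B ∈ laurentSpan k {n | n = (0, 1) ∨ (0 ≤ n.1 ∧ n.1 ≤ d ∧ n.2 = 2)}) :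
    ∃ (b : k) (F : Polynomial k), F.degree ≤ d ∧
      B = (Polynomial.aeval (x k) F * y k + algebraMap k _ b) * y k := by
  induction h using Submodule.span_induction with
  | mem f hf =>
    obtain ⟨n, rfl | ⟨h0, hd, h2⟩, rfl⟩ := hf
    · exact ⟨1, 0, by simp, by simp [laurentMonomial]⟩
    · obtain ⟨a, b⟩ := n
      dsimp only at h0 hd h2
      subst h2
      lift a to ℕ using h0
      refine ⟨0, Polynomial.X ^ a, ?_, ?_⟩
      · rw [Polynomial.degree_X_pow]; exact_mod_cast hd
      · simp only [laurentMonomial, zpow_natCast, map_pow, Polynomial.aeval_X, map_zero, add_zero]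
        rw [mul_assoc, ← sq]
        norm_cast
  | zero => exact ⟨0, 0, by simp, by simp⟩
  | add f g _ _ hf hg =>
    obtain ⟨b, F, hF, rfl⟩ := hf
    obtain ⟨c, G, hG, rfl⟩ := hg
    exact ⟨b + c, F + G, (Polynomial.degree_add_le _ _).trans (max_le hF hG), by
      simp only [map_add]; ring⟩
  | smul c f _ hf =>
    obtain ⟨b, F, hF, rfl⟩ := hf
    exact ⟨c * b, c • F, (Polynomial.degree_smul_le _ _).trans hF, by
      simp only [map_smul]; simp only [Algebra.smul_def, map_mul]; ring⟩

/-- Charts 0 and 3 both have `x` as a coordinate and together force `b = 0`. Chart 1 has `1 / x`,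
and `D x = -x ^ 2 D (1 / x)` allows a pole of order at most two at infinity. -/
theorem IsRegular.apply_x_mem {d : ℕ} {D : VectorField k} (hD : IsRegular d D) :
    D (x k) ∈ laurentSpan k {n | 0 ≤ n.1 ∧ n.1 ≤ 2 ∧ n.2 = 0} := by
  have h0 : D (x k) ∈ chart k d 0 := by simpa [coord] using hD 0 0
  have h3 : D (x k) ∈ chart k d 3 := by simpa [coord] using hD 3 1
  have h1 : D (x k)⁻¹ ∈ chart k d 1 := by simpa [coord] using hD 1 1
  have h1' : D (x k) = -(laurentMonomial k (2, 0) * D (x k)⁻¹) := by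
    have hx := x_ne_zero (k := k)
    have e : laurentMonomial k (2, 0) = x k ^ 2 := by simp [laurentMonomial, sq]
    rw [e, Derivation.leibniz_inv, smul_eq_mul]
    field_simp
  have h1'' : D (x k) ∈ laurentSpan k {n | n.1 - 2 ≤ d * n.2} := by
    rw [h1']
    exact neg_mem (laurentMonomial_mul_mem _ (fun n hn => by
      simpa [add_comm (2 : ℤ)] using hn.2) (chart_one_le h1))
  have := laurentSpan_inf (k := k) _ _ ▸ Submodule.mem_inf.2
    ⟨laurentSpan_inf (k := k) _ _ ▸ Submodule.mem_inf.2 ⟨chart_zero_le h0, chart_three_le h3⟩, h1''⟩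
  refine laurentSpan_mono ?_ this
  rintro ⟨a, b⟩ ⟨⟨⟨ha, hb⟩, -, hb'⟩, h⟩
  obtain rfl : b = 0 := le_antisymm hb' hb
  replace h : a - 2 ≤ d * (0 : ℤ) := h
  exact ⟨ha, by linarith, rfl⟩

/-- Leibniz gives `x ^ (-d) D (x ^ d y) = D y + d (y / x) D x`. Of the terms of `d (y / x) D x`,
only `d a₂ x y` violates the bound `a ≤ d (b - 1)` from chart 1, so it is added to `D y`. -/
theorem IsRegular.apply_y_add_mem {d : ℕ} (hd : 1 ≤ d) {D : VectorField k} (hD : IsRegular d D)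
    {a₀ a₁ a₂ : k} (hA : D (x k) = a₂ • x k ^ 2 + a₁ • x k + algebraMap k _ a₀) :
    D (y k) + ((d : k) * a₂) • (x k * y k) ∈
      laurentSpan k {n | n = (0, 1) ∨ (0 ≤ n.1 ∧ n.1 ≤ d ∧ n.2 = 2)} := by
  have hx := x_ne_zero (k := k)
  have hy := y_ne_zero (k := k)
  have h0 : D (y k) ∈ chart k d 0 := by simpa [coord] using hD 0 1
  have h3 : D (y k)⁻¹ ∈ chart k d 3 := by simpa [coord] using hD 3 0
  have h1 : D (x k ^ d * y k) ∈ chart k d 1 := by simpa [coord] using hD 1 0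
  have exy : x k * y k = laurentMonomial k (1, 1) := by simp [laurentMonomial]
  have h3' : D (y k) = -(laurentMonomial k (0, 2) * D (y k)⁻¹) := by
    have e : laurentMonomial k (0, 2) = y k ^ 2 := by simp [laurentMonomial, sq]
    rw [e, Derivation.leibniz_inv, smul_eq_mul]
    field_simp
  have H0 : D (y k) + ((d : k) * a₂) • (x k * y k) ∈ laurentSpan k {n | 0 ≤ n.1 ∧ 0 ≤ n.2} :=
    add_mem (chart_zero_le h0) (Submodule.smul_mem _ _ (exy ▸ laurentMonomial_mem (by simp)))
  have H3 : D (y k) + ((d : k) * a₂) • (x k * y k) ∈ laurentSpan k {n | n.2 ≤ 2} := by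
    refine add_mem ?_ (Submodule.smul_mem _ _ (exy ▸ laurentMonomial_mem (by simp)))
    rw [h3']
    exact neg_mem (laurentMonomial_mul_mem _ (fun n hn => by simpa using hn.2) (chart_three_le h3))
  have H1 : D (y k) + ((d : k) * a₂) • (x k * y k) ∈
      laurentSpan k {n | n.1 ≤ d * (n.2 - 1)} := by
    have e : D (y k) + ((d : k) * a₂) • (x k * y k) =
        laurentMonomial k (-d, 0) * D (x k ^ d * y k)
          - ((d : k) * a₁) • laurentMonomial k (0, 1)
          - ((d : k) * a₀) • laurentMonomial k (-1, 1) := by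
      -- The power rule produces the truncated exponent `d - 1`; writing `d = e + 1` makes it exact.
      obtain ⟨e, rfl⟩ : ∃ e, d = e + 1 := ⟨d - 1, by omega⟩
      rw [Derivation.leibniz, Derivation.leibniz_pow, hA]
      simp only [laurentMonomial, zpow_neg, zpow_natCast, zpow_zero, zpow_one, mul_one, one_mul,
        smul_eq_mul, nsmul_eq_mul, Algebra.smul_def, map_mul, map_natCast, add_tsub_cancel_right]
      field_simp
      ring
    rw [e]
    refine sub_mem (sub_mem ?_ ?_) ?_
    · refine laurentMonomial_mul_mem _ (fun n hn => ?_) (chart_one_le h1)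
      have := hn.2
      simp only [Set.mem_ofPred_eq, Prod.fst_add, Prod.snd_add, zero_add]
      linarith
    · exact Submodule.smul_mem _ _ (laurentMonomial_mem (by simp))
    · exact Submodule.smul_mem _ _ (laurentMonomial_mem (by simp))
  have := laurentSpan_inf (k := k) _ _ ▸ Submodule.mem_inf.2
    ⟨laurentSpan_inf (k := k) _ _ ▸ Submodule.mem_inf.2 ⟨H0, H3⟩, H1⟩
  refine laurentSpan_mono ?_ this
  rintro ⟨a, b⟩ ⟨⟨⟨ha, hb⟩, hb2⟩, h⟩
  replace ha : 0 ≤ a := ha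
  replace hb : 0 ≤ b := hb
  replace hb2 : b ≤ 2 := hb2
  replace h : a ≤ d * (b - 1) := h
  obtain rfl | rfl | rfl : b = 0 ∨ b = 1 ∨ b = 2 := by omega
  -- For `b = 0` the bounds read `0 ≤ a ≤ -d`, impossible since `d ≥ 1`; for `d = 0` a constant term
  -- would survive.
  · omega
  · left
    obtain rfl : a = 0 := le_antisymm (by simpa using h) ha
    rfl
  · right
    exact ⟨ha, by simpa using h, rfl⟩

/-- The classification of the regular vector fields on a Hirzebruch surface of positive index. -/
theorem IsRegular.exists_eq {d : ℕ} (hd : 1 ≤ d) {D : VectorField k} (hD : IsRegular d D) :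
    ∃ (a₀ a₁ a₂ b : k) (F : Polynomial k), F.degree ≤ d ∧
      D = (a₂ • x k ^ 2 + a₁ • x k + algebraMap k _ a₀) • partialDeriv k 0 +
        ((Polynomial.aeval (x k) F * y k - ((d : k) * a₂) • x k + algebraMap k _ b) * y k) •
          partialDeriv k 1 := by
  obtain ⟨a₀, a₁, a₂, hA⟩ := exists_quadratic hD.apply_x_mem
  obtain ⟨b, F, hF, hB⟩ := exists_linear_add_quadratic (hD.apply_y_add_mem hd hA)
  refine ⟨a₀, a₁, a₂, b, F, hF, ?_⟩
  have hB' : D (y k) =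
      (Polynomial.aeval (x k) F * y k - ((d : k) * a₂) • x k + algebraMap k _ b) * y k := by
    rw [eq_sub_of_add_eq hB]
    simp only [Algebra.smul_def]
    ring
  rw [← hA, ← hB']
  exact vectorField_eq D

end RegularVectorFields

end Hirzebruch

theorem lemma2p3 {k : Type*} [Field k] [IsAlgClosed k] (p : ℕ) [Fact p.Prime] [CharP k p]
    (d : ℕ) (hd : 1 ≤ d) (δ : Hirzebruch.VectorField k) (hδ : δ ≠ 0)
    (hsec : ∃ φ ∈ (Hirzebruch.divisor d δ hδ).globalSections, φ ≠ 0) :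
    ∃ (a₀ a₁ a₂ b : k) (F : Polynomial k), F.degree ≤ d ∧
      Hirzebruch.Equivalent δ
        ((a₂ • Hirzebruch.x k ^ 2 + a₁ • Hirzebruch.x k + algebraMap k _ a₀) •
            Hirzebruch.partialDeriv k 0 +
          ((Polynomial.aeval (Hirzebruch.x k) F * Hirzebruch.y k -
              ((d : k) * a₂) • Hirzebruch.x k + algebraMap k _ b) * Hirzebruch.y k) •
            Hirzebruch.partialDeriv k 1) := by
  obtain ⟨φ, hφ, hφ0⟩ := hsec
  obtain ⟨a₀, a₁, a₂, b, F, hF, h⟩ := (Hirzebruch.isRegular_smul_of_mem_globalSections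
    (Hirzebruch.isDivisorOf_divisor d δ hδ) hφ).exists_eq hd
  -- The normal form is `φ • δ` itself, so the factor of equivalence is `φ⁻¹`.
  exact ⟨a₀, a₁, a₂, b, F, hF, φ⁻¹, inv_ne_zero hφ0, by rw [← h, inv_smul_smul₀ hφ0]⟩
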